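/- Let $w:\mathbb{N}\to\mathbb{R}$ be any function with $w(N)\to\infty$ as $N\to\infty$. Then there are functions $\delta,\eta:\mathbb{N}\to\mathbb{R}$, depending only on $w$, with $\delta(N)\to 0$ and $\eta(N)\to 0$ as $N\to\infty$, such that the following holds for every finite abelian group $G$, written additively, with $N=|G|$. Let $A\subset G$ be a random subset obtained by putting every element of $G$ into $A$ independently with probability $\frac12$, and write $A(\cdot)$ also for the characteristic function of $A$. Then with probability at least $1-\eta(N)$, all sets $X,Y\subset G$ with $$|X|\ge w(N)\,\log N\,(\log\log N)^2,\qquad |Y|\ge w(N)\,\log N\,(\log\log N)^{10}$$ satisfy $$\Bigl|\sum_{x\in X}\sum_{y\in Y}A(x+y)-\tfrac12|X||Y|\Bigr|\le \delta(N)\,|X||Y| .$$ (That is, with probability $1-o(1)$, $\sum_{x\in X}\sum_{y\in Y}A(x+y)=\frac12|X||Y|+o(|X||Y|)$ as $|G|\to\infty$ for all such $X,Y$. For $N\le 2$, where $\log\log N$ is undefined or negative, the claim carries no content, since $\delta$ and $\eta$ are arbitrary at finitely many $N$.) -/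

import Mathlib

open Filter Topology MeasureTheory

universe u

/-- The law of the random subset of `G` to which every element of `G` belongs independently
with probability `1 / 2`. -/
noncomputable def randomSubset (G : Type u) : Measure (Set G) :=
  ProbabilityTheory.setBernoulli Set.univ ⟨1 / 2, by norm_num, by norm_num⟩

/-- The number of pairs `(x, y)` in `X × Y` with `x + y ∈ A`, that is, the sum over `x ∈ X` and
`y ∈ Y` of the characteristic function of `A` at `x + y`. -/
noncomputable def edgeSum {G : Type u} [Add G] (A : Set G) (X Y : Finset G) : ℝ :=
  ∑ x ∈ X, ∑ y ∈ Y, A.indicator (fun _ => (1 : ℝ)) (x + y)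

/-!
Put `f = 2 * 1_A - 1`, a function with independent uniform signs as values. The claim is that with
high probability no pair `X`, `Y` has `|∑ f (x + y)| > δ |X| |Y|`, where `δ → 0` slowly. Passing to
subsets does not decrease the correlation for a suitable choice of subsets
(`exists_subset_card_eq_average`), so `X` and `Y` may be assumed to have prescribed sizes `m` and
`n`. For a single pair, Hoeffding's inequality bounds the probability by
`2 * exp (- (δ m n) ^ 2 / (2 E))`, where `E` is the additive energy of `X` and `Y`. This is too weak
for a union bound over all pairs when `E` is large, and the point of the proof is that large energy
comes with additive structure, which reduces the number of pairs.

*Structure.* By Rudin's inequality (`sum_exp_re_le`), a dissociated set `L` of size `d` has nearly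
minimal energy with any other set: `E (Y, L) ≤ n d τ` with `τ = O (log (n d))`
(`energy_le_of_addDissociated`). Hence a disjoint union `B` of dissociated sets of size `d`
satisfies `E (Y, B) ≤ |B| ^ 2 n τ / d` (`IsDissociatedUnion.energy_le`). The set `X` is split, up to
the element `0`, into layers for `d = 2 ^ j`, one for each `j < J = O (log m)`, such that the layer
at scale `d` is a union of this kind and has no dissociated subset of size `2 d`; it is then
contained in the span of at most `2 d` elements. One of the layers, `B` say, carries a large part of
the correlation (`exists_layer`).

*Sampling.* Restrict to those elements of `Y` that correlate with `B`, and pick `k` of them at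
random, with `k |B|` of order `d δ n / τ`. The sample still correlates with `B`, and its energy
with `B` is at most `3 k |B|` (`exists_sample`, `exists_config`). So the failure probability for one
sample and one layer is at most `exp (- c δ ^ 2 k |B|)`. On the other hand, with `N` the order of
the group, there are at most `N ^ k` samples and `N ^ (2 d) 3 ^ (2 d |B|)` layers, and
this number is smaller than `exp (c δ ^ 2 k |B|)` once `m` exceeds `J (log N) / δ ^ 3` and `n`
exceeds `m τ / δ ^ 3` by large constant factors (`entropy_le`). The union bound then gives
`randomSubset_real_deviation_le`. The sizes in the theorem leave ample room, with `J` and `τ` of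
order `log log N` and `δ` a small negative power of `min (w N) (log log N)`.
-/

open scoped ComplexConjugate

/-! ### Random signs -/

/-- The `±1`-valued function of a set: `1` on the set and `-1` off it. -/
noncomputable def signOf {G : Type*} (A : Set G) (g : G) : ℝ :=
  open Classical in if g ∈ A then 1 else -1

lemma abs_signOf {G : Type*} (A : Set G) (g : G) : |signOf A g| = 1 := by
  unfold signOf; split_ifs <;> simp

instance {G : Type u} : IsProbabilityMeasure (randomSubset G) := by
  unfold randomSubset; infer_instance

lemma randomSubset_real_singleton {G : Type u} [Fintype G] (A : Set G) :
    (randomSubset G).real {A} = (1 / 2) ^ Fintype.card G := by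
  classical
  unfold randomSubset
  rw [ProbabilityTheory.setBernoulli_real_singleton _ (Set.subset_univ A) Set.finite_univ]
  have h : A.ncard + (Set.univ \ A).ncard = Fintype.card G := by
    rw [← Nat.card_eq_fintype_card, ← Set.ncard_univ, ← Set.compl_eq_univ_sdiff,
      Set.ncard_add_ncard_compl, Set.ncard_univ]
  rw [← h, pow_add]
  norm_num

/-- The exponential moment of a linear form in independent random signs. -/
lemma sum_exp_sum_signOf {G : Type u} [Fintype G] (c : G → ℝ) :
    ∑ A : Finset G, Real.exp (∑ g, signOf (A : Set G) g * c g)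
      = 2 ^ Fintype.card G * ∏ g, Real.cosh (c g) := by
  classical
  have h1 : ∀ A : Finset G, Real.exp (∑ g, signOf (A : Set G) g * c g)
      = (∏ g ∈ A, Real.exp (c g)) * ∏ g ∈ Finset.univ \ A, Real.exp (-c g) := by
    intro A
    rw [Real.exp_sum, ← Finset.prod_sdiff (Finset.subset_univ A), mul_comm]
    congr 1
    · exact Finset.prod_congr rfl fun g hg => by simp [signOf, hg]
    · refine Finset.prod_congr rfl fun g hg => ?_
      have : g ∉ A := by simpa using hg
      simp [signOf, this]
  simp_rw [h1]
  rw [← Finset.powerset_univ, ← Finset.prod_add]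
  simp_rw [Real.cosh_eq]
  rw [← Finset.card_univ, Finset.prod_div_distrib, Finset.prod_const]
  field_simp

/-- Hoeffding's inequality for the signs of a random subset. -/
lemma randomSubset_real_le_exp {G : Type u} [Fintype G] (r : G → ℝ) {V t : ℝ} (hV : 0 < V)
    (ht : 0 ≤ t) (hr : ∑ g, r g ^ 2 ≤ V) :
    (randomSubset G).real {A | t ≤ ∑ g, signOf A g * r g} ≤ Real.exp (-(t ^ 2 / (2 * V))) := by
  classical
  set S : Set (Set G) := {A | t ≤ ∑ g, signOf A g * r g}
  set F : Finset (Finset G) := Finset.univ.filter fun A => (A : Set G) ∈ S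
  have hS : S ⊆ ⋃ A ∈ F, {(A : Set G)} := by
    intro A hA
    simp only [Set.mem_iUnion, Set.mem_singleton_iff]
    exact ⟨A.toFinset, by simp [F, hA], by simp⟩
  have h1 : (randomSubset G).real S ≤ ∑ A ∈ F, (1 / 2 : ℝ) ^ Fintype.card G := by
    calc _ ≤ (randomSubset G).real (⋃ A ∈ F, {(A : Set G)}) :=
          measureReal_mono hS (measure_ne_top _ _)
      _ ≤ ∑ A ∈ F, (randomSubset G).real {(A : Set G)} := measureReal_biUnion_finset_le _ _
      _ = _ := by simp_rw [randomSubset_real_singleton]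
  set l : ℝ := t / V
  have hl : 0 ≤ l := div_nonneg ht hV.le
  have h2 : ∑ A ∈ F, (1 / 2 : ℝ) ^ Fintype.card G
      ≤ ∑ A : Finset G, (1 / 2 : ℝ) ^ Fintype.card G *
        (Real.exp (-(l * t)) * Real.exp (∑ g, signOf (A : Set G) g * (l * r g))) := by
    refine le_trans (Finset.sum_le_sum fun A hA => ?_)
      (Finset.sum_le_sum_of_subset_of_nonneg (Finset.subset_univ F) fun _ _ _ => by positivity)
    refine le_mul_of_one_le_right (by positivity) ?_
    rw [← Real.exp_add]
    refine Real.one_le_exp ?_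
    have hA' : t ≤ ∑ g, signOf (A : Set G) g * r g := by
      have := (Finset.mem_filter.1 hA).2
      exact this
    have : ∑ g, signOf (A : Set G) g * (l * r g) = l * ∑ g, signOf (A : Set G) g * r g := by
      rw [Finset.mul_sum]; exact Finset.sum_congr rfl fun _ _ => by ring
    rw [this]
    nlinarith
  have h3 : ∏ g, Real.cosh (l * r g) ≤ Real.exp (l ^ 2 * V / 2) := by
    calc _ ≤ ∏ g, Real.exp ((l * r g) ^ 2 / 2) :=
          Finset.prod_le_prod (fun _ _ => (Real.cosh_pos _).le)
            fun g _ => Real.cosh_le_exp_half_sq _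
      _ = Real.exp (∑ g, (l * r g) ^ 2 / 2) := (Real.exp_sum _ _).symm
      _ ≤ _ := by
          refine Real.exp_le_exp.2 ?_
          have : ∑ g, (l * r g) ^ 2 / 2 = l ^ 2 * (∑ g, r g ^ 2) / 2 := by
            rw [Finset.mul_sum, Finset.sum_div]
            exact Finset.sum_congr rfl fun _ _ => by ring
          rw [this]
          gcongr
  refine h1.trans (h2.trans ?_)
  rw [← Finset.mul_sum, ← Finset.mul_sum, sum_exp_sum_signOf]
  calc _ = Real.exp (-(l * t)) * ∏ g, Real.cosh (l * r g) := by
        have : ((1 : ℝ) / 2) ^ Fintype.card G * 2 ^ Fintype.card G = 1 := by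
          rw [← mul_pow]; norm_num
        linear_combination (Real.exp (-(l * t)) * ∏ g, Real.cosh (l * r g)) * this
    _ ≤ Real.exp (-(l * t)) * Real.exp (l ^ 2 * V / 2) := by gcongr
    _ = _ := by
        rw [← Real.exp_add]
        congr 1
        simp only [l]
        field_simp
        ring

lemma addChar_map_sum {G : Type*} [AddCommGroup G] (χ : AddChar G ℂ) (s : Finset G) :
    χ (∑ x ∈ s, x) = ∏ x ∈ s, χ x := by
  classical
  induction s using Finset.induction_on with
  | empty => simp
  | insert a s ha ih => rw [Finset.sum_insert ha, Finset.prod_insert ha, AddChar.map_add_eq_mul, ih]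

/-! ### Rudin's inequality for dissociated sets -/

section Rudin

variable {G : Type u} [AddCommGroup G] [Fintype G]

/-- Averaged over all characters, the Riesz product of a dissociated set equals its constant
term: dissociativity makes every other term of the expanded product a nontrivial character sum. -/
lemma sum_riesz_product (L : Finset G) (hL : AddDissociated (L : Set G)) (C S c : ℂ) :
    ∑ χ : AddChar G ℂ, ∏ x ∈ L, (C + S * (c * χ x + conj c * χ (-x)))
      = Fintype.card G * C ^ L.card := by
  classical
  have h1 : ∀ χ : AddChar G ℂ, ∏ x ∈ L, (C + S * (c * χ x + conj c * χ (-x)))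
      = ∑ T ∈ L.powerset, ∑ U ∈ T.powerset,
        (C ^ (L \ T).card * S ^ T.card * c ^ U.card * (conj c) ^ (T \ U).card) *
          χ (∑ x ∈ U, x - ∑ x ∈ T \ U, x) := by
    intro χ
    simp_rw [add_comm C]
    rw [Finset.prod_add]
    refine Finset.sum_congr rfl fun T _ => ?_
    rw [Finset.prod_mul_distrib, Finset.prod_add, Finset.prod_const, Finset.prod_const,
      Finset.mul_sum, Finset.sum_mul]
    refine Finset.sum_congr rfl fun U _ => ?_
    rw [Finset.prod_mul_distrib, Finset.prod_mul_distrib, Finset.prod_const, Finset.prod_const,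
      sub_eq_add_neg, AddChar.map_add_eq_mul, ← Finset.sum_neg_distrib, addChar_map_sum]
    have : χ (∑ x ∈ T \ U, -x) = ∏ x ∈ T \ U, χ (-x) := by
      rw [Finset.sum_neg_distrib, AddChar.map_neg_eq_conj, addChar_map_sum]
      simp_rw [AddChar.map_neg_eq_conj]
      simp
    rw [this]
    ring
  simp_rw [h1]
  rw [Finset.sum_comm]
  simp_rw [Finset.sum_comm (s := (Finset.univ : Finset (AddChar G ℂ)))]
  simp_rw [← Finset.mul_sum, AddChar.sum_apply_eq_ite]
  rw [Finset.sum_eq_single_of_mem ∅ (Finset.empty_mem_powerset L)]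
  · simp [mul_comm]
  · intro T hT hT0
    refine Finset.sum_eq_zero fun U hU => ?_
    rw [Finset.mem_powerset] at hT hU
    rw [if_neg, mul_zero]
    intro h
    have hUT : U = T \ U := by
      refine hL (x₁ := U) (x₂ := T \ U) ?_ ?_ (sub_eq_zero.1 h)
      · exact Finset.coe_subset.2 (hU.trans hT)
      · exact Finset.coe_subset.2 <| Finset.sdiff_subset.trans hT
    refine hT0 (Finset.eq_empty_of_forall_notMem fun x hx => ?_)
    by_cases hxU : x ∈ U
    · have := hxU
      rw [hUT] at this
      exact (Finset.mem_sdiff.1 this).2 hxU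
    · exact hxU (hUT ▸ Finset.mem_sdiff.2 ⟨hx, hxU⟩)

/-- Rudin's inequality, in exponential form: the Fourier transform of a dissociated set has
subgaussian tails in every direction `c`. -/
lemma sum_exp_re_le (L : Finset G) (hL : AddDissociated (L : Set G)) (c : ℂ) (hc : ‖c‖ = 1)
    (t : ℝ) :
    ∑ χ : AddChar G ℂ, Real.exp (t * (c * ∑ x ∈ L, χ x).re)
      ≤ Fintype.card G * Real.exp (L.card * (t ^ 2 / 2)) := by
  have h1 : ∀ χ : AddChar G ℂ, Real.exp (t * (c * ∑ x ∈ L, χ x).re)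
      ≤ ∏ x ∈ L, (Real.cosh t + (c * χ x).re * Real.sinh t) := by
    intro χ
    rw [Finset.mul_sum, Complex.re_sum, Finset.mul_sum, Real.exp_sum]
    refine Finset.prod_le_prod (fun _ _ => (Real.exp_pos _).le) fun x _ => ?_
    rw [mul_comm t]
    refine Real.exp_mul_le_cosh_add_mul_sinh ?_ t
    refine (Complex.abs_re_le_norm _).trans ?_
    rw [norm_mul, hc, AddChar.norm_apply, one_mul]
  have h2 : ((∑ χ : AddChar G ℂ, ∏ x ∈ L, (Real.cosh t + (c * χ x).re * Real.sinh t) : ℝ) : ℂ)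
      = ((Fintype.card G * Real.cosh t ^ L.card : ℝ) : ℂ) := by
    push_cast
    rw [← sum_riesz_product L hL _ ((Real.sinh t : ℂ) / 2) c]
    push_cast
    refine Finset.sum_congr rfl fun χ _ => Finset.prod_congr rfl fun x _ => ?_
    rw [Complex.re_eq_add_conj, AddChar.map_neg_eq_conj, map_mul]
    ring
  calc _ ≤ ∑ χ : AddChar G ℂ, ∏ x ∈ L, (Real.cosh t + (c * χ x).re * Real.sinh t) :=
        Finset.sum_le_sum fun χ _ => h1 χ
    _ = Fintype.card G * Real.cosh t ^ L.card := by exact_mod_cast h2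
    _ ≤ _ := by
        rw [Real.exp_nat_mul]
        gcongr
        exact Real.cosh_le_exp_half_sq t

/-- Only few characters see a large Fourier coefficient of a dissociated set. -/
lemma card_large_spectrum_le (L : Finset G) (hL : AddDissociated (L : Set G)) (hL0 : L.Nonempty)
    (s : ℝ) (hs : 0 ≤ s) :
    ((Finset.univ.filter fun χ : AddChar G ℂ => 2 * s ^ 2 < ‖∑ x ∈ L, χ x‖ ^ 2).card : ℝ)
      ≤ 4 * Fintype.card G * Real.exp (-(s ^ 2 / (2 * L.card))) := by
  set d : ℝ := (L.card : ℝ)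
  have hd : 0 < d := Nat.cast_pos.2 hL0.card_pos
  set t : ℝ := s / d
  have ht : 0 ≤ t := div_nonneg hs hd.le
  set F := Finset.univ.filter fun χ : AddChar G ℂ => 2 * s ^ 2 < ‖∑ x ∈ L, χ x‖ ^ 2
  set e : ℂ → AddChar G ℂ → ℝ := fun c χ => Real.exp (t * (c * ∑ x ∈ L, χ x).re)
  have h1 : ∀ χ ∈ F, Real.exp (t * s) ≤ e 1 χ + e (-1) χ + e Complex.I χ + e (-Complex.I) χ := by
    intro χ hχ
    have h := (Finset.mem_filter.1 hχ).2
    simp only [e]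
    set z := ∑ x ∈ L, χ x
    have p1 := Real.exp_pos (t * (1 * z).re)
    have p2 := Real.exp_pos (t * (-1 * z).re)
    have p3 := Real.exp_pos (t * (Complex.I * z).re)
    have p4 := Real.exp_pos (t * (-Complex.I * z).re)
    rw [← Complex.normSq_eq_norm_sq, Complex.normSq_apply] at h
    have key : ∀ c : ℂ, s ≤ (c * z).re → Real.exp (t * s) ≤ Real.exp (t * (c * z).re) :=
      fun c hc => Real.exp_le_exp.2 (mul_le_mul_of_nonneg_left hc ht)
    rcases le_or_gt s |z.re| with h' | h'
    · rcases le_abs'.1 h' with h' | h'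
      · have := key (-1) (by simpa using by linarith)
        linarith
      · have := key 1 (by simpa using h')
        linarith
    · rcases le_or_gt s |z.im| with h'' | h''
      · rcases le_abs'.1 h'' with h'' | h''
        · have := key Complex.I (by simpa using by linarith)
          linarith
        · have := key (-Complex.I) (by simpa using h'')
          linarith
      · have a1 : z.re * z.re ≤ s ^ 2 := by
          have := abs_le.1 h'.le; nlinarith
        have a2 : z.im * z.im ≤ s ^ 2 := by
          have := abs_le.1 h''.le; nlinarith
        linarith
  have h2 : (F.card : ℝ) * Real.exp (t * s)
      ≤ 4 * (Fintype.card G * Real.exp (d * (t ^ 2 / 2))) := by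
    calc (F.card : ℝ) * Real.exp (t * s) = ∑ χ ∈ F, Real.exp (t * s) := by simp
      _ ≤ ∑ χ ∈ F, (e 1 χ + e (-1) χ + e Complex.I χ + e (-Complex.I) χ) := Finset.sum_le_sum h1
      _ ≤ ∑ χ, (e 1 χ + e (-1) χ + e Complex.I χ + e (-Complex.I) χ) :=
          Finset.sum_le_sum_of_subset_of_nonneg (Finset.subset_univ _) fun _ _ _ => by positivity
      _ = ∑ χ, e 1 χ + ∑ χ, e (-1) χ + ∑ χ, e Complex.I χ + ∑ χ, e (-Complex.I) χ := by
          simp only [Finset.sum_add_distrib]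
      _ ≤ _ := by
          have a1 := sum_exp_re_le L hL 1 (by simp) t
          have a2 := sum_exp_re_le L hL (-1) (by simp) t
          have a3 := sum_exp_re_le L hL Complex.I (by simp) t
          have a4 := sum_exp_re_le L hL (-Complex.I) (by simp) t
          simp only [e]
          linarith
  have h3 : Real.exp (d * (t ^ 2 / 2)) = Real.exp (-(s ^ 2 / (2 * d))) * Real.exp (t * s) := by
    rw [← Real.exp_add]
    congr 1
    simp only [t]
    field_simp
    ring
  rw [h3, ← mul_assoc, ← mul_assoc] at h2
  exact le_of_mul_le_mul_right h2 (Real.exp_pos _)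

end Rudin

/-! ### Additive energy -/

section Energy

variable {G : Type u} [AddCommGroup G] [Fintype G]

/-- The number of representations `g = a + b` with `a ∈ A` and `b ∈ B`. -/
noncomputable def repCount (A B : Finset G) (g : G) : ℝ :=
  ∑ a ∈ A, (B : Set G).indicator (fun _ => (1 : ℝ)) (g - a)

/-- The additive energy of `A` and `B`: the number of solutions of `a + b = a' + b'`,
written as the sum of the squares of the representation counts. -/
noncomputable def energy (A B : Finset G) : ℝ := ∑ g, repCount A B g ^ 2

lemma sum_indicator_sub (B : Finset G) (a : G) (h : G → ℂ) :
    ∑ g, (((B : Set G).indicator (fun _ => (1 : ℝ)) (g - a) : ℝ) : ℂ) * h g = ∑ b ∈ B, h (a + b) := by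
  classical
  rw [← Equiv.sum_comp (Equiv.addLeft a)]
  simp [Set.indicator_apply, apply_ite Complex.ofReal]

lemma sum_repCount_mul_addChar (A B : Finset G) (χ : AddChar G ℂ) :
    ∑ g, (repCount A B g : ℂ) * χ g = (∑ a ∈ A, χ a) * ∑ b ∈ B, χ b := by
  simp only [repCount, Complex.ofReal_sum, Finset.sum_mul]
  rw [Finset.sum_comm]
  refine Finset.sum_congr rfl fun a _ => ?_
  rw [sum_indicator_sub, Finset.mul_sum]
  simp only [AddChar.map_add_eq_mul]

/-- Parseval's identity for real functions on a finite abelian group. -/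
lemma sum_norm_sq_fourier (h : G → ℝ) :
    ∑ χ : AddChar G ℂ, ‖∑ g, (h g : ℂ) * χ g‖ ^ 2 = Fintype.card G * ∑ g, h g ^ 2 := by
  classical
  have key : ((∑ χ : AddChar G ℂ, ‖∑ g, (h g : ℂ) * χ g‖ ^ 2 : ℝ) : ℂ)
      = ((Fintype.card G * ∑ g, h g ^ 2 : ℝ) : ℂ) := by
    push_cast
    simp_rw [← Complex.conj_mul', map_sum, Finset.sum_mul_sum, map_mul, Complex.conj_ofReal,
      ← AddChar.map_neg_eq_conj]
    have h1 : ∀ (χ : AddChar G ℂ) (i j : G),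
        (h i : ℂ) * χ (-i) * (h j * χ j) = (h i * h j) * χ (j - i) := by
      intro χ i j
      rw [sub_eq_add_neg, AddChar.map_add_eq_mul]
      ring
    simp_rw [h1]
    rw [Finset.sum_comm]
    simp_rw [Finset.sum_comm (s := (Finset.univ : Finset (AddChar G ℂ))), ← Finset.mul_sum,
      AddChar.sum_apply_eq_ite, sub_eq_zero, mul_ite, mul_zero]
    simp only [Finset.sum_ite_eq', Finset.mem_univ, if_true]
    rw [Finset.mul_sum]
    exact Finset.sum_congr rfl fun _ _ => by ring
  exact_mod_cast key

lemma card_mul_energy (A B : Finset G) :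
    Fintype.card G * energy A B
      = ∑ χ : AddChar G ℂ, ‖∑ a ∈ A, χ a‖ ^ 2 * ‖∑ b ∈ B, χ b‖ ^ 2 := by
  rw [energy, ← sum_norm_sq_fourier]
  simp_rw [sum_repCount_mul_addChar, norm_mul, mul_pow]

lemma sum_norm_sq_fourier_finset (A : Finset G) :
    ∑ χ : AddChar G ℂ, ‖∑ a ∈ A, χ a‖ ^ 2 = Fintype.card G * A.card := by
  classical
  have := sum_norm_sq_fourier ((A : Set G).indicator fun _ => (1 : ℝ))
  simpa [Set.indicator_apply, apply_ite Complex.ofReal] using this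

/-- A dissociated set has almost minimal additive energy with any other set. -/
lemma energy_le_of_addDissociated (A L : Finset G) (hL : AddDissociated (L : Set G))
    (hA : A.Nonempty) (hL0 : L.Nonempty) :
    energy A L ≤ A.card * L.card * (4 * Real.log (4 * A.card * L.card) + 1) := by
  set N : ℝ := (Fintype.card G : ℝ)
  have hN : 0 < N := by
    exact Nat.cast_pos.2 (Fintype.card_pos_iff.2 ⟨0⟩)
  set n : ℝ := (A.card : ℝ)
  set d : ℝ := (L.card : ℝ)
  have hn : 1 ≤ n := Nat.one_le_cast.2 hA.card_pos
  have hd : 1 ≤ d := Nat.one_le_cast.2 hL0.card_pos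
  have hlog : 0 ≤ Real.log (4 * n * d) := Real.log_nonneg (by nlinarith)
  -- `2 * s ^ 2` is the threshold at which the exceptional characters number at most `N / (n * d)`.
  set s : ℝ := Real.sqrt (2 * d * Real.log (4 * n * d))
  have hs2 : s ^ 2 = 2 * d * Real.log (4 * n * d) := Real.sq_sqrt (by positivity)
  have hF := card_large_spectrum_le L hL hL0 s (Real.sqrt_nonneg _)
  set F := Finset.univ.filter fun χ : AddChar G ℂ => 2 * s ^ 2 < ‖∑ x ∈ L, χ x‖ ^ 2
  have hF' : (F.card : ℝ) * (n * d) ≤ N := by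
    have : Real.exp (-(s ^ 2 / (2 * (L.card : ℝ)))) = (4 * n * d)⁻¹ := by
      rw [hs2, mul_div_cancel_left₀ _ (by positivity), Real.exp_neg, Real.exp_log (by positivity)]
    rw [this] at hF
    calc (F.card : ℝ) * (n * d) ≤ 4 * N * (4 * n * d)⁻¹ * (n * d) := by gcongr
      _ = N := by field_simp
  have hb : ∀ (B : Finset G) (χ : AddChar G ℂ), ‖∑ x ∈ B, χ x‖ ^ 2 ≤ (B.card : ℝ) ^ 2 := by
    intro B χ
    gcongr
    refine (norm_sum_le _ _).trans ?_
    simp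
  have key : N * energy A L ≤ N * (n * d * (4 * Real.log (4 * n * d) + 1)) := by
    rw [card_mul_energy]
    calc _ ≤ ∑ χ : AddChar G ℂ, (‖∑ a ∈ A, χ a‖ ^ 2 * (2 * s ^ 2)
            + if χ ∈ F then n ^ 2 * d ^ 2 else 0) := by
          refine Finset.sum_le_sum fun χ _ => ?_
          split_ifs with hχ
          · have := mul_le_mul (hb A χ) (hb L χ) (by positivity) (by positivity)
            have h0 : 0 ≤ ‖∑ a ∈ A, χ a‖ ^ 2 * (2 * s ^ 2) := by positivity
            linarith
          · rw [add_zero]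
            refine mul_le_mul_of_nonneg_left ?_ (by positivity)
            simpa [F] using hχ
      _ = N * n * (2 * s ^ 2) + F.card * (n * d) * (n * d) := by
          rw [Finset.sum_add_distrib, ← Finset.sum_mul, sum_norm_sq_fourier_finset]
          simp
          ring
      _ ≤ N * n * (2 * s ^ 2) + N * (n * d) := by gcongr
      _ = _ := by rw [hs2]; ring
  exact le_of_mul_le_mul_left key hN

lemma energy_biUnion_le [DecidableEq G] (A : Finset G) (P : Finset (Finset G))
    (hP : (P : Set (Finset G)).PairwiseDisjoint id) :
    energy A (P.biUnion id) ≤ P.card * ∑ L ∈ P, energy A L := by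
  have h1 : ∀ g, repCount A (P.biUnion id) g = ∑ L ∈ P, repCount A L g := by
    intro g
    simp only [repCount]
    rw [Finset.sum_comm]
    refine Finset.sum_congr rfl fun a _ => ?_
    have := Finset.sum_biUnion (s := P) (t := id)
      (f := fun x => if x = g - a then (1 : ℝ) else 0) hP
    simpa only [Set.indicator_apply, Finset.mem_coe, id, Finset.sum_ite_eq'] using this
  simp only [energy, h1]
  rw [Finset.sum_comm, Finset.mul_sum]
  exact Finset.sum_le_sum fun g _ => sq_sum_le_card_mul_sum_sq

end Energy

/-! ### Decomposition into dissociated layers -/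

section Decomposition

variable {G : Type u} [AddCommGroup G]

/-- `B` is a disjoint union of dissociated sets of size exactly `d`. -/
def IsDissociatedUnion [DecidableEq G] (d : ℕ) (B : Finset G) : Prop :=
  ∃ P : Finset (Finset G), (P : Set (Finset G)).PairwiseDisjoint id ∧ P.biUnion id = B ∧
    ∀ L ∈ P, AddDissociated (L : Set G) ∧ L.card = d

variable [DecidableEq G]

lemma IsDissociatedUnion.empty (d : ℕ) : IsDissociatedUnion d (∅ : Finset G) :=
  ⟨∅, by simp, by simp, by simp⟩

lemma IsDissociatedUnion.union {d : ℕ} {B L : Finset G} (hB : IsDissociatedUnion d B)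
    (hL : AddDissociated (L : Set G)) (hd : L.card = d) (hLB : Disjoint L B) :
    IsDissociatedUnion d (L ∪ B) := by
  obtain ⟨P, hP, rfl, hP'⟩ := hB
  refine ⟨insert L P, ?_, by simp, ?_⟩
  · rw [Finset.coe_insert]
    refine hP.insert fun M hM _ => ?_
    exact hLB.mono_right (Finset.subset_biUnion_of_mem id hM)
  · intro M hM
    rcases Finset.mem_insert.1 hM with rfl | hM
    exacts [⟨hL, hd⟩, hP' M hM]

lemma IsDissociatedUnion.le_card {d : ℕ} {B : Finset G} (hB : IsDissociatedUnion d B)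
    (hB0 : B.Nonempty) : d ≤ B.card := by
  obtain ⟨P, hP, rfl, hP'⟩ := hB
  obtain ⟨x, hx⟩ := hB0
  obtain ⟨L, hL, -⟩ := Finset.mem_biUnion.1 hx
  rw [← (hP' L hL).2]
  exact Finset.card_le_card (Finset.subset_biUnion_of_mem id hL)

lemma IsDissociatedUnion.energy_le [Fintype G] {d : ℕ} (hd : 0 < d) {B : Finset G}
    (hB : IsDissociatedUnion d B) (A : Finset G) (hA : A.Nonempty) :
    d * energy A B ≤ (B.card : ℝ) ^ 2 * A.card * (4 * Real.log (4 * A.card * d) + 1) := by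
  obtain ⟨P, hP, rfl, hP'⟩ := hB
  have hc : ((P.biUnion id).card : ℝ) = P.card * d := by
    rw [Finset.card_biUnion (fun x hx y hy hxy => hP hx hy hxy),
      Finset.sum_congr rfl fun L hL => show (id L).card = d from (hP' L hL).2]
    simp
  have h1 : ∑ L ∈ P, energy A L ≤ P.card * (A.card * d * (4 * Real.log (4 * A.card * d) + 1)) := by
    rw [← nsmul_eq_mul]
    refine Finset.sum_le_card_nsmul _ _ _ fun L hL => ?_
    have := energy_le_of_addDissociated A L (hP' L hL).1 hA
      (Finset.card_pos.1 ((hP' L hL).2.symm ▸ hd))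
    rwa [(hP' L hL).2] at this
  have h2 := energy_biUnion_le A P hP
  calc (d : ℝ) * energy A (P.biUnion id) ≤ d * (P.card * ∑ L ∈ P, energy A L) := by gcongr
    _ ≤ d * (P.card * (P.card * (A.card * d * (4 * Real.log (4 * A.card * d) + 1)))) := by gcongr
    _ = _ := by rw [hc]; ring

/-- Greedy extraction of disjoint dissociated sets of size `d`. -/
lemma exists_isDissociatedUnion (d : ℕ) (hd : 0 < d) (B : Finset G) :
    ∃ B' ⊆ B, IsDissociatedUnion d B' ∧
      ∀ L ⊆ B \ B', AddDissociated (L : Set G) → L.card < d := by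
  induction B using Finset.strongInduction with
  | H B ih =>
    by_cases h : ∀ L ⊆ B, AddDissociated (L : Set G) → L.card < d
    · exact ⟨∅, by simp, IsDissociatedUnion.empty d, by simpa using h⟩
    · push Not at h
      obtain ⟨L', hL'B, hL', hdL'⟩ := h
      obtain ⟨L, hLL', hLd⟩ := Finset.exists_subset_card_eq hdL'
      have hL : AddDissociated (L : Set G) := hL'.subset (by exact_mod_cast hLL')
      have hLB := hLL'.trans hL'B
      have hL0 : L.Nonempty := Finset.card_pos.1 (hLd ▸ hd)
      obtain ⟨B'', hB'', hU, hmax⟩ := ih (B \ L) (Finset.sdiff_ssubset hLB hL0)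
      refine ⟨L ∪ B'', Finset.union_subset hLB (hB''.trans Finset.sdiff_subset),
        hU.union hL hLd (Finset.disjoint_sdiff.mono_right hB''), ?_⟩
      rwa [sdiff_sdiff_left, Finset.sup_eq_union] at hmax

/-- Multiscale decomposition: peeling off disjoint dissociated sets of sizes `2 ^ (J - 1)`, …, `2`,
`1` in turn exhausts `B` up to the element `0`, and each layer, being left over from the previous
one, has no dissociated subset of twice its scale. One layer must carry a large part of the total
of `φ`. -/
lemma exists_layer (φ : G → ℝ) (s : ℝ) (J : ℕ) (B : Finset G)
    (hB : ∀ L ⊆ B, AddDissociated (L : Set G) → L.card < 2 ^ J)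
    (hφ : J * s + |φ 0| < ∑ b ∈ B, φ b) :
    ∃ j < J, ∃ B' ⊆ B, IsDissociatedUnion (2 ^ j) B' ∧
      (∀ L ⊆ B', AddDissociated (L : Set G) → L.card < 2 ^ (j + 1)) ∧ s < ∑ b ∈ B', φ b := by
  induction J generalizing B with
  | zero =>
    exfalso
    have hB0 : B ⊆ {0} := by
      intro x hx
      by_contra hx0
      have := hB {x} (by simpa using hx) (by simpa using hx0)
      simp at this
    have : ∑ b ∈ B, φ b ≤ |φ 0| := by
      rcases Finset.subset_singleton_iff.1 hB0 with rfl | rfl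
      · simp
      · simpa using le_abs_self _
    simp at hφ
    linarith
  | succ J ih =>
    obtain ⟨B', hB', hU, hmax⟩ := exists_isDissociatedUnion (2 ^ J) (by positivity) B
    by_cases hs : s < ∑ b ∈ B', φ b
    · exact ⟨J, J.lt_succ_self, B', hB', hU, fun L hL => hB L (hL.trans hB'), hs⟩
    · obtain ⟨j, hj, B'', hB'', h⟩ := ih (B \ B') hmax (by
        have := Finset.sum_sdiff hB' (f := φ)
        push_cast at hφ
        linarith)
      exact ⟨j, hj.trans J.lt_succ_self, B'', hB''.trans Finset.sdiff_subset, h⟩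

end Decomposition

/-! ### Random sampling -/

section Sampling

/-- First and second moments of the sum of `k` independent uniform samples of `u`. -/
lemma sum_sq_sum_samples {α : Type*} [Fintype α] [Nonempty α] (u : α → ℝ) (k : ℕ) :
    ∑ a : Fin k → α, ∑ i, u (a i)
        = (Fintype.card α : ℝ) ^ k * (k * ((∑ x, u x) / Fintype.card α)) ∧
    ∑ a : Fin k → α, (∑ i, u (a i)) ^ 2
        = (Fintype.card α : ℝ) ^ k * (k * ((∑ x, u x ^ 2) / Fintype.card α)
          + k * (k - 1) * ((∑ x, u x) / Fintype.card α) ^ 2) := by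
  have hn : (Fintype.card α : ℝ) ≠ 0 := Nat.cast_ne_zero.2 Fintype.card_ne_zero
  induction k with
  | zero => simp
  | succ k ih =>
    obtain ⟨h1, h2⟩ := ih
    constructor
    · rw [← (Fin.consEquiv fun _ => α).sum_comp, Fintype.sum_prod_type]
      simp only [Fin.consEquiv_apply, Fin.sum_univ_succ, Fin.cons_zero, Fin.cons_succ,
        Finset.sum_add_distrib, h1]
      simp only [Finset.sum_const, Finset.card_univ, Fintype.card_pi, Finset.prod_const,
        Fintype.card_fin, nsmul_eq_mul, ← Finset.mul_sum]
      push_cast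
      field_simp
      ring
    · rw [← (Fin.consEquiv fun _ => α).sum_comp, Fintype.sum_prod_type]
      simp only [Fin.consEquiv_apply, Fin.sum_univ_succ, Fin.cons_zero, Fin.cons_succ, add_sq,
        Finset.sum_add_distrib, ← Finset.mul_sum, h1, h2]
      simp only [Finset.sum_const, Finset.card_univ, Fintype.card_pi, Finset.prod_const,
        Fintype.card_fin, nsmul_eq_mul, ← Finset.mul_sum, ← Finset.sum_mul]
      push_cast
      field_simp
      ring

variable {G : Type u} [AddCommGroup G] [Fintype G]

/-- Sampling `k` elements of `A` scales the off-diagonal part of the energy with `B` by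
`(k / |A|) ^ 2`, while the diagonal part is only `k * |B|`. -/
lemma exists_sample (A B : Finset G) (hA : A.Nonempty) (k : ℕ) :
    ∃ a : Fin k → G, (∀ i, a i ∈ A) ∧
      ∑ g, (∑ i, (B : Set G).indicator (fun _ => (1 : ℝ)) (g - a i)) ^ 2
        ≤ k * B.card + k ^ 2 * (energy A B / A.card ^ 2) := by
  classical
  have : Nonempty A := hA.to_subtype
  have hn : (0 : ℝ) < A.card := Nat.cast_pos.2 hA.card_pos
  set U : G → G → ℝ := fun g a => (B : Set G).indicator (fun _ => (1 : ℝ)) (g - a)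
  have h1 : ∑ g, ∑ a : A, U g a ^ 2 = A.card * B.card := by
    have h : ∀ a : A, ∑ g, U g a ^ 2 = B.card := by
      intro a
      rw [← Equiv.sum_comp (Equiv.addLeft (a : G))]
      simp [U, Set.indicator_apply]
    rw [Finset.sum_comm]
    simp [h]
  have h2 : ∑ g, (∑ a : A, U g a) ^ 2 = energy A B := by
    refine Finset.sum_congr rfl fun g _ => ?_
    rw [repCount, ← Finset.sum_coe_sort A]
  have h3 : ∑ a : Fin k → A, ∑ g, (∑ i, U g (a i)) ^ 2
      ≤ ∑ a : Fin k → A, (k * B.card + k ^ 2 * (energy A B / A.card ^ 2) : ℝ) := by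
    rw [Finset.sum_comm]
    have h := fun g => (sum_sq_sum_samples (fun a : A => U g a) k).2
    simp_rw [h, ← Finset.mul_sum,
      Finset.sum_add_distrib, ← Finset.mul_sum, div_pow, ← Finset.sum_div, h1, h2]
    simp only [Finset.sum_const, Finset.card_univ, Fintype.card_pi, Finset.prod_const,
        Fintype.card_fin, nsmul_eq_mul, Fintype.card_coe, Nat.cast_pow]
    rw [mul_div_cancel_left₀ _ hn.ne']
    have hE : 0 ≤ (k : ℝ) * ((A.card : ℝ) ^ k * (energy A B / A.card ^ 2)) :=
      mul_nonneg k.cast_nonneg (mul_nonneg (by positivity) (div_nonneg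
        (Finset.sum_nonneg fun _ _ => sq_nonneg _) (by positivity)))
    rw [mul_div_assoc]
    linarith
  obtain ⟨a, -, ha⟩ := Finset.exists_le_of_sum_le Finset.univ_nonempty h3
  exact ⟨fun i => a i, fun i => (a i).2, ha⟩

end Sampling

/-! ### Encoding of samples and layers -/

section Configurations

variable {G : Type u} [AddCommGroup G]

/-- The `l`-th point of the combinatorial cube generated by `x`, with coordinates `e l`. -/
def cubePoint {D M : ℕ} (x : Fin D → G) (e : Fin M → Fin D → SignType) (l : Fin M) : G :=
  ∑ i, (e l i : ℤ) • x i

/-- The number of pairs `(i, l)` such that `g` is the sum of `a i` and of the `l`-th cube point.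
The pair `(x, e)` encodes a set of `M` points of small additive dimension. -/
noncomputable def pairCount {k D M : ℕ} (a : Fin k → G) (x : Fin D → G)
    (e : Fin M → Fin D → SignType) (g : G) : ℝ :=
  open Classical in ∑ i, ∑ l, if a i + cubePoint x e l = g then 1 else 0

lemma sum_mul_pairCount [Fintype G] {k D M : ℕ} (a : Fin k → G) (x : Fin D → G)
    (e : Fin M → Fin D → SignType) (f : G → ℝ) :
    ∑ g, f g * pairCount a x e g = ∑ i, ∑ l, f (a i + cubePoint x e l) := by
  classical
  simp only [pairCount, Finset.mul_sum]
  rw [Finset.sum_comm]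
  refine Finset.sum_congr rfl fun i _ => ?_
  rw [Finset.sum_comm]
  refine Finset.sum_congr rfl fun l _ => ?_
  simp

/-- A finite set of size at most `D`, listed with repetitions of `0` allowed. -/
lemma exists_tuple (S : Finset G) (D : ℕ) (hS : S.card ≤ D) :
    ∃ x : Fin D → G, ∀ h : G → G, h 0 = 0 → ∑ i, h (x i) = ∑ y ∈ S, h y := by
  classical
  induction D generalizing S with
  | zero =>
    rw [Nat.le_zero, Finset.card_eq_zero] at hS
    subst hS
    exact ⟨0, by simp⟩
  | succ D ih =>
    rcases S.eq_empty_or_nonempty with rfl | ⟨y, hy⟩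
    · exact ⟨0, fun h h0 => by simp [h0]⟩
    · obtain ⟨x, hx⟩ := ih (S.erase y) (by rw [Finset.card_erase_of_mem hy]; omega)
      refine ⟨Fin.cons y x, fun h h0 => ?_⟩
      rw [Fin.sum_univ_succ]
      simp only [Fin.cons_zero, Fin.cons_succ]
      rw [hx h h0, Finset.add_sum_erase S h hy]

/-- A set all of whose dissociated subsets have size at most `D` is listed by cube points in
dimension `D`. -/
lemma exists_cubePoint_eq [Fintype G] (B : Finset G) (D : ℕ)
    (hB : ∀ L ⊆ B, AddDissociated (L : Set G) → L.card ≤ D) :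
    ∃ (x : Fin D → G) (e : Fin B.card → Fin D → SignType),
      ∀ h : G → ℝ, ∑ l, h (cubePoint x e l) = ∑ b ∈ B, h b := by
  classical
  obtain ⟨S, -, hSD, hS⟩ := Finset.exists_subset_addSpan_card_le_of_forall_addDissociated hB
  obtain ⟨x, hx⟩ := exists_tuple S D hSD
  have hb : ∀ b : B, ∃ c : Fin D → SignType, ∑ i, (c i : ℤ) • x i = b := by
    intro b
    obtain ⟨ε, hε, hsum⟩ := Finset.mem_addSpan.1 (hS b.2)
    refine ⟨fun i => SignType.sign (ε (x i)), ?_⟩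
    rw [← hsum, ← hx (fun y => ε y • y) (smul_zero _)]
    refine Finset.sum_congr rfl fun i _ => ?_
    rcases hε (x i) with h | h | h <;> simp [h]
  choose c hc using hb
  refine ⟨x, fun l => c (B.equivFin.symm l), fun h => ?_⟩
  simp only [cubePoint, hc]
  rw [Equiv.sum_comp B.equivFin.symm (fun b : B => h b), Finset.sum_coe_sort]

/-- Union bound over all triples `(a, x, e)` whose pair counts have second moment at most `V`. -/
lemma randomSubset_real_config_le [Fintype G] (k D M : ℕ) {V t : ℝ} (hV : 0 < V) (ht : 0 ≤ t) :
    (randomSubset G).real {A | ∃ (a : Fin k → G) (x : Fin D → G) (e : Fin M → Fin D → SignType),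
      ∑ g, pairCount a x e g ^ 2 ≤ V ∧ t ≤ |∑ g, signOf A g * pairCount a x e g|}
      ≤ (Fintype.card G : ℝ) ^ (k + D) * 3 ^ (D * M) * (2 * Real.exp (-(t ^ 2 / (2 * V)))) := by
  classical
  set E := (Fin k → G) × (Fin D → G) × (Fin M → Fin D → SignType)
  set r : E → G → ℝ := fun p => pairCount p.1 p.2.1 p.2.2
  set F : Finset E := Finset.univ.filter fun p => ∑ g, r p g ^ 2 ≤ V
  set Bad : E → Set (Set G) := fun p => {A | t ≤ |∑ g, signOf A g * r p g|}
  have hbad : ∀ p ∈ F, (randomSubset G).real (Bad p) ≤ 2 * Real.exp (-(t ^ 2 / (2 * V))) := by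
    intro p hp
    have hp' := (Finset.mem_filter.1 hp).2
    have h1 := randomSubset_real_le_exp (r p) hV ht hp'
    have h2 := randomSubset_real_le_exp (fun g => -r p g) hV ht (by simpa using hp')
    have hsub : Bad p ⊆ {A | t ≤ ∑ g, signOf A g * r p g} ∪
        {A | t ≤ ∑ g, signOf A g * -r p g} := by
      intro A hA
      rcases le_abs.1 (show t ≤ |∑ g, signOf A g * r p g| from hA) with h | h
      · exact Or.inl h
      · exact Or.inr (by simpa using h)
    have h3 := (measureReal_mono hsub (measure_ne_top (randomSubset G) _)).trans
      (measureReal_union_le _ _)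
    linarith
  calc _ ≤ (randomSubset G).real (⋃ p ∈ F, Bad p) := by
        refine measureReal_mono ?_ (measure_ne_top _ _)
        rintro A ⟨a, x, e, h1, h2⟩
        simp only [Set.mem_iUnion]
        exact ⟨(a, x, e), Finset.mem_filter.2 ⟨Finset.mem_univ _, h1⟩, h2⟩
    _ ≤ ∑ p ∈ F, (randomSubset G).real (Bad p) := measureReal_biUnion_finset_le _ _
    _ ≤ ∑ p ∈ F, 2 * Real.exp (-(t ^ 2 / (2 * V))) := Finset.sum_le_sum hbad
    _ ≤ ∑ p : E, 2 * Real.exp (-(t ^ 2 / (2 * V))) :=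
        Finset.sum_le_sum_of_subset_of_nonneg (Finset.subset_univ _) fun _ _ _ => by positivity
    _ = _ := by
        have hc : Fintype.card E = Fintype.card G ^ (k + D) * 3 ^ (D * M) := by
          have h3 : Fintype.card SignType = 3 := rfl
          simp only [E, Fintype.card_prod, Fintype.card_pi, Finset.prod_const, Finset.card_univ,
            Fintype.card_fin, h3]
          rw [pow_add, pow_mul, mul_assoc]
        rw [Finset.sum_const, Finset.card_univ, hc, nsmul_eq_mul]
        push_cast
        ring

end Configurations

/-! ### From a large correlation to a configuration -/

section Structure

variable {G : Type u} [AddCommGroup G] [Fintype G]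

/-- A correlation of `f` with `X + Y` of density `δ` is already visible on `k` points of `Y` and
one layer `B` of `X`. The layer has additive dimension of order `2 ^ j`, and `k` is as large as
allowed by the requirement that the representation counts of the sample be essentially bounded
on average. -/
lemma exists_config (f : G → ℝ) (hf : ∀ g, |f g| ≤ 1) (X Y : Finset G) (δ τ : ℝ) (J : ℕ)
    (hδ : 0 < δ) (hY : Y.Nonempty) (hJ : 0 < J) (hXJ : X.card < 2 ^ J)
    (hτ : τ = 4 * Real.log (4 * Y.card * X.card) + 1)
    (hXδ : 8 ≤ δ * X.card) (hYδ : 4 * X.card * τ ≤ δ * Y.card)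
    (hsum : δ * (X.card * Y.card) ≤ ∑ x ∈ X, ∑ y ∈ Y, f (x + y)) :
    ∃ j < J, ∃ M ≤ X.card, 2 ^ j ≤ M ∧ δ * X.card ≤ 8 * J * M ∧
      ∃ (a : Fin ⌈2 ^ j * δ * Y.card / (4 * M * τ)⌉₊ → G) (x : Fin (2 ^ (j + 1)) → G)
        (e : Fin M → Fin (2 ^ (j + 1)) → SignType),
        ∑ g, pairCount a x e g ^ 2 ≤ 3 * (⌈2 ^ j * δ * Y.card / (4 * M * τ)⌉₊ * M) ∧
        δ / 4 * (⌈2 ^ j * δ * Y.card / (4 * M * τ)⌉₊ * M) ≤ ∑ g, f g * pairCount a x e g := by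
  classical
  set m : ℝ := (X.card : ℝ)
  set n : ℝ := (Y.card : ℝ)
  have hn : 1 ≤ n := Nat.one_le_cast.2 hY.card_pos
  have hm : 1 ≤ m := by
    have : X.card ≠ 0 := by
      intro h
      simp only [m, h] at hXδ
      norm_num at hXδ
    exact Nat.one_le_cast.2 (Nat.pos_of_ne_zero this)
  have hτ1 : 1 ≤ τ := by
    have := Real.log_nonneg (show (1 : ℝ) ≤ 4 * n * m by nlinarith)
    linarith
  have hJ' : (1 : ℝ) ≤ J := Nat.one_le_cast.2 hJ
  have hfsum : ∀ (S : Finset G) (h : G → G), |∑ b ∈ S, f (h b)| ≤ S.card := by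
    intro S h
    refine (Finset.abs_sum_le_sum_abs _ _).trans ?_
    calc _ ≤ ∑ b ∈ S, (1 : ℝ) := Finset.sum_le_sum fun b _ => hf _
      _ = _ := by simp
  set φ : G → ℝ := fun b => ∑ y ∈ Y, f (b + y) - δ / 2 * n
  have hδm : δ * m * n ≤ m * n := by
    have h1 : ∑ x ∈ X, ∑ y ∈ Y, f (x + y) ≤ ∑ x ∈ X, n :=
      Finset.sum_le_sum fun x _ => (le_abs_self _).trans (hfsum Y _)
    simp only [Finset.sum_const, nsmul_eq_mul] at h1
    linarith
  have hδ1 : δ ≤ 1 := by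
    have : 0 < m * n := by positivity
    nlinarith
  have hφ : J * (δ * m * n / (8 * J)) + |φ 0| < ∑ b ∈ X, φ b := by
    have h0 : |φ 0| ≤ n + δ / 2 * n := by
      refine (abs_sub _ _).trans ?_
      rw [abs_of_nonneg (show 0 ≤ δ / 2 * n by positivity)]
      exact add_le_add_left (hfsum Y _) _
    have h1 : ∑ b ∈ X, φ b = ∑ x ∈ X, ∑ y ∈ Y, f (x + y) - m * (δ / 2 * n) := by
      simp [φ, m]
    have h2 : J * (δ * m * n / (8 * J)) = δ * m * n / 8 := by field_simp
    rw [h1, h2]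
    nlinarith
  obtain ⟨j, hj, B, hBX, hU, hdim, hs⟩ := exists_layer φ _ J X
    (fun L hL _ => (Finset.card_le_card hL).trans_lt hXJ) hφ
  set F : G → ℝ := fun a => ∑ b ∈ B, f (a + b)
  have hB0 : B.Nonempty := by
    by_contra h
    rw [Finset.not_nonempty_iff_eq_empty] at h
    rw [h, Finset.sum_empty] at hs
    exact absurd hs (not_lt.2 (by positivity))
  have hM : (1 : ℝ) ≤ B.card := Nat.one_le_cast.2 hB0.card_pos
  set M : ℝ := (B.card : ℝ)
  have hMm : M ≤ m := Nat.cast_le.2 (Finset.card_le_card hBX)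
  have hdM : 2 ^ j ≤ B.card := hU.le_card hB0
  have hdM' : (2 : ℝ) ^ j ≤ M := by simpa [M] using (Nat.cast_le (α := ℝ)).2 hdM
  have hF : δ * m * n / (8 * J) + M * (δ / 2 * n) < ∑ a ∈ Y, F a := by
    have h1 : ∑ b ∈ B, φ b = ∑ a ∈ Y, F a - M * (δ / 2 * n) := by
      simp only [φ, F, M]
      rw [Finset.sum_sub_distrib, Finset.sum_comm]
      simp [add_comm]
    linarith
  have hFM : ∀ a, F a ≤ M := fun a => (le_abs_self _).trans (hfsum B _)
  have hMJ : δ * m ≤ 8 * J * M := by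
    have h1 : ∑ a ∈ Y, F a ≤ ∑ a ∈ Y, M := Finset.sum_le_sum fun a _ => hFM a
    simp only [Finset.sum_const, nsmul_eq_mul] at h1
    have h2 : δ * m * n / (8 * J) ≤ n * M := by
      have : 0 ≤ M * (δ / 2 * n) := by positivity
      linarith
    rw [div_le_iff₀ (by positivity)] at h2
    nlinarith
  set A := Y.filter fun a => δ / 4 * M ≤ F a
  have hA : δ / 4 * n ≤ A.card := by
    have h1 : ∑ a ∈ Y, F a ≤ A.card * M + n * (δ / 4 * M) := by
      rw [← Finset.sum_filter_add_sum_filter_not Y fun a => δ / 4 * M ≤ F a]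
      refine add_le_add ?_ ?_
      · rw [← nsmul_eq_mul]
        exact Finset.sum_le_card_nsmul _ _ _ fun a _ => hFM a
      · refine (Finset.sum_le_card_nsmul _ _ (δ / 4 * M) fun a ha => ?_).trans ?_
        · exact (not_le.1 (Finset.mem_filter.1 ha).2).le
        · rw [nsmul_eq_mul]
          refine mul_le_mul_of_nonneg_right ?_ (by positivity)
          exact Nat.cast_le.2 (Finset.card_filter_le _ _)
    have h2 : 0 ≤ δ * m * n / (8 * J) := by positivity
    have h3 : (δ / 4 * n) * M ≤ A.card * M := by linarith
    exact le_of_mul_le_mul_right h3 (by positivity)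
  have hApos : (0 : ℝ) < A.card := lt_of_lt_of_le (by positivity) hA
  have hA0 : A.Nonempty := Finset.card_pos.1 (Nat.cast_pos.1 hApos)
  have hAn : (A.card : ℝ) ≤ n := Nat.cast_le.2 (Finset.card_filter_le _ _)
  have hE : 2 ^ j * energy A B ≤ M ^ 2 * A.card * τ := by
    have h1 := hU.energy_le (by positivity) A hA0
    push_cast at h1
    refine h1.trans ?_
    rw [hτ]
    gcongr
    linarith
  set k : ℕ := ⌈2 ^ j * δ * n / (4 * M * τ)⌉₊
  have hk : (k : ℝ) * (4 * M * τ) ≤ 2 * (2 ^ j * δ * n) := by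
    have h1 : (k : ℝ) < 2 ^ j * δ * n / (4 * M * τ) + 1 := Nat.ceil_lt_add_one (by positivity)
    have h2 : 0 < 4 * M * τ := by positivity
    have h3 : (k : ℝ) * (4 * M * τ) ≤ 2 ^ j * δ * n + 4 * M * τ := by
      calc (k : ℝ) * (4 * M * τ) ≤ (2 ^ j * δ * n / (4 * M * τ) + 1) * (4 * M * τ) := by gcongr
        _ = _ := by field_simp
    have h4 : 4 * M * τ ≤ 4 * m * τ := by gcongr
    have h5 : δ * n ≤ 2 ^ j * δ * n := by
      have : (1 : ℝ) ≤ 2 ^ j := one_le_pow₀ (by norm_num)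
      have : 0 ≤ δ * n := by positivity
      nlinarith
    linarith
  obtain ⟨a, haA, ha⟩ := exists_sample A B hA0 k
  obtain ⟨x, e, hxe⟩ := exists_cubePoint_eq B (2 ^ (j + 1)) fun L hL h => (hdim L hL h).le
  refine ⟨j, hj, B.card, Finset.card_le_card hBX, hdM, hMJ, a, x, e, ?_, ?_⟩
  · have hcount : ∀ g, pairCount a x e g
        = ∑ i, (B : Set G).indicator (fun _ => (1 : ℝ)) (g - a i) := by
      intro g
      simp only [pairCount]
      refine Finset.sum_congr rfl fun i _ => ?_
      rw [hxe fun b => if a i + b = g then 1 else 0]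
      have : ∀ b, a i + b = g ↔ b = g - a i := fun b => by
        rw [eq_sub_iff_add_eq, add_comm]
      simp [this, Set.indicator_apply]
    simp_rw [hcount]
    refine ha.trans ?_
    have h1 : energy A B ≤ M ^ 2 * A.card * τ / 2 ^ j := by
      rw [le_div_iff₀ (by positivity)]
      linarith
    have h2 : energy A B / A.card ^ 2 ≤ 4 * M ^ 2 * τ / (2 ^ j * δ * n) := by
      calc energy A B / (A.card : ℝ) ^ 2 ≤ (M ^ 2 * A.card * τ / 2 ^ j) / (A.card : ℝ) ^ 2 := by
            gcongr
        _ = M ^ 2 * τ / (2 ^ j * A.card) := by field_simp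
        _ ≤ M ^ 2 * τ / (2 ^ j * (δ / 4 * n)) := by gcongr
        _ = _ := by field_simp
    have h3 : (k : ℝ) ^ 2 * (4 * M ^ 2 * τ / (2 ^ j * δ * n)) ≤ 2 * (k * M) := by
      have : (k : ℝ) ^ 2 * (4 * M ^ 2 * τ / (2 ^ j * δ * n))
          = (k * M) * ((k * (4 * M * τ)) / (2 ^ j * δ * n)) := by ring
      rw [this, mul_comm (2 : ℝ)]
      gcongr
      rw [div_le_iff₀ (by positivity)]
      exact hk
    have h4 : (k : ℝ) ^ 2 * (energy A B / A.card ^ 2)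
        ≤ (k : ℝ) ^ 2 * (4 * M ^ 2 * τ / (2 ^ j * δ * n)) := by gcongr
    linarith
  · rw [sum_mul_pairCount]
    calc δ / 4 * (k * M) = ∑ i : Fin k, δ / 4 * M := by simp; ring
      _ ≤ _ := Finset.sum_le_sum fun i _ => by
          rw [hxe fun b => f (a i + b)]
          exact (Finset.mem_filter.1 (haA i)).2

end Structure

/-! ### The probability of a large deviation -/

section Deviation

/-- Some subset of size `m` does at least as well as the whole set on average. -/
lemma exists_subset_card_eq_average {α : Type*} (F : α → ℝ) (c : ℝ) (m : ℕ) (X : Finset α)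
    (hm : m ≤ X.card) (hX : c * X.card ≤ ∑ x ∈ X, F x) :
    ∃ X' ⊆ X, X'.card = m ∧ c * m ≤ ∑ x ∈ X', F x := by
  classical
  induction X using Finset.strongInduction with
  | H X ih =>
    rcases hm.eq_or_lt with rfl | hlt
    · exact ⟨X, subset_rfl, rfl, hX⟩
    · have hX0 : X.Nonempty := Finset.card_pos.1 (by omega)
      have hpos : (0 : ℝ) < X.card := Nat.cast_pos.2 hX0.card_pos
      set p := (∑ x ∈ X, F x) / X.card
      obtain ⟨y, hy, hyp⟩ := Finset.exists_le_of_sum_le (f := F) (g := fun _ => p) hX0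
        (by simp only [Finset.sum_const, nsmul_eq_mul, p]; rw [mul_div_cancel₀ _ hpos.ne'])
      have hcp : c ≤ p := by rwa [le_div_iff₀ hpos]
      have hsum : ∑ x ∈ X, F x = p * X.card := by simp only [p]; field_simp
      have hcard : ((X.erase y).card : ℝ) = X.card - 1 := by
        rw [Finset.card_erase_of_mem hy, Nat.cast_sub hX0.card_pos, Nat.cast_one]
      obtain ⟨X', hX', h⟩ := ih (X.erase y) (Finset.erase_ssubset hy)
        (by rw [Finset.card_erase_of_mem hy]; omega) (by
          have h1 := Finset.add_sum_erase X F hy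
          have h2 : (1 : ℝ) ≤ X.card := Nat.one_le_cast.2 hX0.card_pos
          rw [hcard]
          nlinarith)
      exact ⟨X', hX'.trans (Finset.erase_subset _ _), h⟩

lemma edgeSum_sub_half {G : Type u} [AddCommGroup G] (A : Set G) (X Y : Finset G) :
    edgeSum A X Y - 1 / 2 * (X.card : ℝ) * (Y.card : ℝ)
      = (∑ x ∈ X, ∑ y ∈ Y, signOf A (x + y)) / 2 := by
  classical
  have h : ∀ g, A.indicator (fun _ => (1 : ℝ)) g = signOf A g / 2 + 1 / 2 := by
    intro g
    by_cases hg : g ∈ A <;> simp [signOf, hg] <;> norm_num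
  simp only [edgeSum, h, Finset.sum_add_distrib, ← Finset.sum_div]
  simp
  ring

/-- For fixed `k` and fixed dimension and size `M` of the layer, the subgaussian tail beats the
number of triples `(a, x, e)`. Here `d` is the dissociation scale, and the
cardinality of the sample makes `k * M` of order `d * δ * n / τ`. -/
lemma entropy_le (N d M m n J δ τ k : ℝ) (hN : 1 ≤ Real.log N) (hδ : 0 < δ) (hδ1 : δ ≤ 1)
    (hd : 1 ≤ d) (hM : 1 ≤ M) (hMm : M ≤ m) (hτ : 1 ≤ τ)
    (hJ : 1 ≤ J) (hm : 10000 * J * Real.log N ≤ δ ^ 3 * m)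
    (hn : 4000 * m * τ ≤ δ ^ 3 * n) (hMJ : δ * m ≤ 8 * J * M)
    (hk1 : 1 ≤ k) (hk : d * δ * n ≤ 4 * τ * (k * M)) :
    (k + 2 * d) * Real.log N + 2 * d * M * Real.log 3 + 3 * Real.log N
      ≤ (δ / 4 * (k * M)) ^ 2 / (2 * (3 * (k * M))) := by
  set L := Real.log N
  have hl3 : Real.log 3 ≤ 2 := by
    have := Real.log_le_sub_one_of_pos (show (0 : ℝ) < 3 by norm_num)
    linarith
  have hkM : 0 < k * M := by positivity
  have hrhs : (δ / 4 * (k * M)) ^ 2 / (2 * (3 * (k * M))) = δ ^ 2 * (k * M) / 96 := by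
    field_simp
    ring
  rw [hrhs]
  -- `M` is large: `1250 * L ≤ δ ^ 2 * M`
  have h1 : 1250 * L ≤ δ ^ 2 * M := by
    have : δ ^ 2 * (δ * m) ≤ δ ^ 2 * (8 * J * M) := by gcongr
    have : J * (1250 * L) ≤ J * (δ ^ 2 * M) := by nlinarith
    exact le_of_mul_le_mul_left this (by linarith)
  have hδ2 : δ ^ 2 ≤ 1 := pow_le_one₀ hδ.le hδ1
  have hLM : L ≤ M := by nlinarith
  have h2 : d * (4000 * m) ≤ 4 * (δ ^ 2 * (k * M)) := by
    have e1 : d * (4000 * m * τ) ≤ d * (δ ^ 3 * n) := by gcongr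
    have e2 : δ ^ 2 * (d * δ * n) ≤ δ ^ 2 * (4 * τ * (k * M)) := by gcongr
    have : τ * (d * (4000 * m)) ≤ τ * (4 * (δ ^ 2 * (k * M))) := by nlinarith
    exact le_of_mul_le_mul_left this (by linarith)
  have h3 : 1250 * (k * L) ≤ δ ^ 2 * (k * M) := by nlinarith
  have h4 : L ≤ k * L := by nlinarith
  have h5 : d * L ≤ d * m := by gcongr; linarith
  have h6 : d * M * Real.log 3 ≤ d * m * 2 := by
    have : 0 ≤ Real.log 3 := Real.log_nonneg (by norm_num)
    have : 0 ≤ m := by linarith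
    gcongr
  linarith [h2, h3, h4, h5, h6]

variable {G : Type u} [AddCommGroup G] [Fintype G]

/-- Finitary form of the theorem: explicit conditions on the minimal sizes `m` of `X` and `n` of `Y`
under which a relative deviation `δ` is unlikely to occur for any pair. -/
theorem randomSubset_real_deviation_le (m n J : ℕ) (δ τ : ℝ)
    (hN : 1 ≤ Real.log (Fintype.card G)) (hδ : 0 < δ) (hδ1 : δ ≤ 1) (hJ : 0 < J) (hmJ : m < 2 ^ J)
    (hτ : τ = 4 * Real.log (4 * n * m) + 1)
    (hm : 10000 * J * Real.log (Fintype.card G) ≤ δ ^ 3 * m)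
    (hn : 4000 * m * τ ≤ δ ^ 3 * n) :
    (randomSubset G).real {A | ∃ X Y : Finset G, m ≤ X.card ∧ n ≤ Y.card ∧
      δ * (X.card * Y.card) < |edgeSum A X Y - 1 / 2 * (X.card : ℝ) * (Y.card : ℝ)|}
      ≤ 4 / Fintype.card G := by
  set N : ℝ := (Fintype.card G : ℝ)
  have hNpos : 0 < N := Nat.cast_pos.2 (Fintype.card_pos_iff.2 ⟨0⟩)
  have hJ' : (1 : ℝ) ≤ J := Nat.one_le_cast.2 hJ
  have hδ3 : δ ^ 3 ≤ 1 := pow_le_one₀ hδ.le hδ1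
  have hδ3' : 0 < δ ^ 3 := by positivity
  have hδ3δ : δ ^ 3 ≤ δ := by simpa using pow_le_pow_of_le_one hδ.le hδ1 (show 1 ≤ 3 by norm_num)
  have hm4 : 10000 * (J : ℝ) ≤ δ ^ 3 * m := le_trans (by nlinarith) hm
  have hmpos : (1 : ℝ) ≤ m := by
    have : δ ^ 3 * (m : ℝ) ≤ m := mul_le_of_le_one_left m.cast_nonneg hδ3
    linarith
  have hJm : (J : ℝ) ≤ m := by
    have : δ ^ 3 * (m : ℝ) ≤ m := mul_le_of_le_one_left m.cast_nonneg hδ3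
    linarith
  have hn0 : n ≠ 0 := by
    rintro rfl
    simp only [Nat.cast_zero, mul_zero, zero_mul, Real.log_zero, zero_add] at hτ hn
    rw [hτ] at hn
    linarith
  have hnpos : (1 : ℝ) ≤ n := Nat.one_le_cast.2 (Nat.pos_of_ne_zero hn0)
  have hτ1 : 1 ≤ τ := by
    have := Real.log_nonneg (show (1 : ℝ) ≤ 4 * n * m by nlinarith)
    linarith
  by_cases hmN : Fintype.card G < m
  · -- no set `X` is large enough
    have : {A : Set G | ∃ X Y : Finset G, m ≤ X.card ∧ n ≤ Y.card ∧
        δ * (X.card * Y.card) < |edgeSum A X Y - 1 / 2 * (X.card : ℝ) * (Y.card : ℝ)|} = ∅ := by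
      refine Set.eq_empty_of_forall_notMem ?_
      rintro A ⟨X, Y, hX, -⟩
      exact absurd (Finset.card_le_univ X) (by omega)
    rw [this, measureReal_empty]
    positivity
  have hmN' : (m : ℝ) ≤ N := Nat.cast_le.2 (not_lt.1 hmN)
  set K : ℕ → ℕ → ℕ := fun j M => ⌈2 ^ j * δ * n / (4 * M * τ)⌉₊
  set Cond : ℕ → ℕ → Prop := fun j M => 2 ^ j ≤ M ∧ δ * m ≤ 8 * J * M
  set Bad : ℕ → ℕ → Set (Set G) := fun j M => {A | Cond j M ∧
    ∃ (a : Fin (K j M) → G) (x : Fin (2 ^ (j + 1)) → G) (e : Fin M → Fin (2 ^ (j + 1)) → SignType),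
      ∑ g, pairCount a x e g ^ 2 ≤ 3 * (K j M * M) ∧
      δ / 4 * (K j M * M) ≤ |∑ g, signOf A g * pairCount a x e g|}
  have hbad : ∀ j, ∀ M ≤ m, (randomSubset G).real (Bad j M) ≤ 2 / N ^ 3 := by
    intro j M hMm
    by_cases hc : Cond j M
    swap
    · have : Bad j M = ∅ := Set.eq_empty_of_forall_notMem fun A hA => hc hA.1
      rw [this, measureReal_empty]
      positivity
    have hM1 : (1 : ℝ) ≤ M := Nat.one_le_cast.2 (Nat.one_le_two_pow.trans hc.1)
    have hKpos : 0 < K j M := Nat.ceil_pos.2 (by positivity)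
    have hK1 : (1 : ℝ) ≤ K j M := Nat.one_le_cast.2 hKpos
    have hKM : 2 ^ j * δ * n ≤ 4 * τ * (K j M * M) := by
      have h1 : 2 ^ j * δ * n / (4 * M * τ) ≤ (K j M : ℝ) := Nat.le_ceil _
      rw [div_le_iff₀ (by positivity)] at h1
      linarith
    have hent := entropy_le N (2 ^ j) M m n J δ τ (K j M) hN hδ hδ1
      (one_le_pow₀ (by norm_num)) hM1 (Nat.cast_le.2 hMm) hτ1 hJ' hm hn hc.2 hK1 hKM
    have hle := randomSubset_real_config_le (G := G) (K j M) (2 ^ (j + 1)) M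
      (V := 3 * (K j M * M)) (t := δ / 4 * (K j M * M)) (by positivity) (by positivity)
    refine (measureReal_mono (fun A hA => hA.2) (measure_ne_top _ _)).trans (hle.trans ?_)
    have e1 : N ^ (K j M + 2 ^ (j + 1)) = Real.exp ((K j M + 2 * 2 ^ j) * Real.log N) := by
      rw [← Real.exp_log (pow_pos hNpos _), Real.log_pow]
      push_cast
      ring_nf
    have e2 : (3 : ℝ) ^ (2 ^ (j + 1) * M) = Real.exp (2 * 2 ^ j * M * Real.log 3) := by
      rw [← Real.exp_log (pow_pos (show (0 : ℝ) < 3 by norm_num) _), Real.log_pow]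
      push_cast
      ring_nf
    have e3 : 2 / N ^ 3 = 2 * Real.exp (-(3 * Real.log N)) := by
      have : (3 : ℝ) * Real.log N = Real.log (N ^ 3) := by rw [Real.log_pow]; norm_num
      rw [this, Real.exp_neg, Real.exp_log (by positivity)]
      ring
    rw [e3, mul_left_comm]
    change 2 * (N ^ (K j M + 2 ^ (j + 1)) * _ * _) ≤ _
    rw [e1, e2, ← Real.exp_add, ← Real.exp_add]
    gcongr
    linarith
  have hcover : {A : Set G | ∃ X Y : Finset G, m ≤ X.card ∧ n ≤ Y.card ∧
      δ * (X.card * Y.card) < |edgeSum A X Y - 1 / 2 * (X.card : ℝ) * (Y.card : ℝ)|}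
      ⊆ ⋃ j ∈ Finset.range J, ⋃ M ∈ Finset.range (m + 1), Bad j M := by
    rintro A ⟨X₀, Y₀, hX₀, hY₀, hdev⟩
    rw [edgeSum_sub_half, abs_div, abs_two] at hdev
    have hdev' : δ * (X₀.card * Y₀.card) ≤ |∑ x ∈ X₀, ∑ y ∈ Y₀, signOf A (x + y)| := by
      have := abs_nonneg (∑ x ∈ X₀, ∑ y ∈ Y₀, signOf A (x + y))
      linarith
    obtain ⟨σ, hσ, hσsum⟩ : ∃ σ : ℝ, |σ| = 1 ∧
        δ * (X₀.card * Y₀.card) ≤ ∑ x ∈ X₀, ∑ y ∈ Y₀, σ * signOf A (x + y) := by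
      simp only [← Finset.mul_sum]
      rcases le_abs.1 hdev' with h | h
      · exact ⟨1, by simp, by linarith⟩
      · exact ⟨-1, by simp, by linarith⟩
    -- pass to subsets of sizes exactly `m` and `n`
    obtain ⟨X, -, hXm, hX⟩ := exists_subset_card_eq_average
      (fun x => ∑ y ∈ Y₀, σ * signOf A (x + y)) (δ * Y₀.card) m X₀ hX₀ (by linarith)
    rw [Finset.sum_comm] at hX
    obtain ⟨Y, -, hYn, hXY⟩ := exists_subset_card_eq_average
      (fun y => ∑ x ∈ X, σ * signOf A (x + y)) (δ * m) n Y₀ hY₀ (by linarith)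
    rw [Finset.sum_comm] at hXY
    subst hXm hYn
    obtain ⟨j, hj, M, hMX, hjM, hMJ, a, x, e, h1, h2⟩ :=
      exists_config (fun g => σ * signOf A g) (fun g => by rw [abs_mul, hσ, abs_signOf, one_mul])
        X Y δ τ J hδ (Finset.card_pos.1 (Nat.pos_of_ne_zero hn0)) hJ hmJ hτ
        (by nlinarith) (by nlinarith) (by linarith)
    simp only [Set.mem_iUnion, Finset.mem_range]
    refine ⟨j, hj, M, Nat.lt_succ_of_le hMX, ⟨hjM, hMJ⟩, a, x, e, h1, h2.trans ?_⟩
    simp only [mul_assoc, ← Finset.mul_sum]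
    refine (le_abs_self _).trans_eq ?_
    rw [abs_mul, hσ, one_mul]
  calc _ ≤ (randomSubset G).real (⋃ j ∈ Finset.range J, ⋃ M ∈ Finset.range (m + 1), Bad j M) :=
        measureReal_mono hcover (measure_ne_top _ _)
    _ ≤ ∑ j ∈ Finset.range J, ∑ M ∈ Finset.range (m + 1), (randomSubset G).real (Bad j M) :=
        (measureReal_biUnion_finset_le _ _).trans
          (Finset.sum_le_sum fun j _ => measureReal_biUnion_finset_le _ _)
    _ ≤ ∑ j ∈ Finset.range J, ∑ M ∈ Finset.range (m + 1), 2 / N ^ 3 :=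
        Finset.sum_le_sum fun j _ => Finset.sum_le_sum fun M hM =>
          hbad j M (Nat.lt_succ_iff.1 (Finset.mem_range.1 hM))
    _ = J * (m + 1) * (2 / N ^ 3) := by
        simp only [Finset.sum_const, Finset.card_range, nsmul_eq_mul]
        push_cast
        ring
    _ ≤ N * (N + N) * (2 / N ^ 3) := by
        gcongr <;> linarith
    _ = 4 / N := by field_simp; ring

end Deviation

/-! ### Choice of sizes -/

section Asymptotics

/-- The sizes `m = ⌈s ^ 4 * L * l ^ 2⌉` and `n = ⌈s ^ 4 * L * l ^ 10⌉`, where `L = log N` and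
`l = log L`, meet the requirements of the finitary form with `δ = 1 / s`, as soon as `l` is large
and `s ^ 4 ≤ l`. -/
lemma size_conditions (L l s : ℝ) (hlL : l = Real.log L) (hl : 40000 ≤ l) (hL : 2 * l ^ 11 ≤ L)
    (hs : 1 ≤ s) (hsl : s ^ 4 ≤ l) (m n J : ℕ) (hm : m = ⌈s ^ 4 * L * l ^ 2⌉₊)
    (hn : n = ⌈s ^ 4 * L * l ^ 10⌉₊) (hJ : J = Nat.log 2 m + 1) :
    10000 * J * L ≤ (1 / s) ^ 3 * m ∧
      4000 * m * (4 * Real.log (4 * n * m) + 1) ≤ (1 / s) ^ 3 * n := by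
  have hl0 : 0 < l := by linarith
  have hl1 : 1 ≤ l := by linarith
  have hl11 : 1 ≤ l ^ 11 := one_le_pow₀ hl1
  have hL1 : 1 ≤ L := by linarith
  have hs4 : 1 ≤ s ^ 4 := one_le_pow₀ hs
  have hm1 : s ^ 4 * L * l ^ 2 ≤ m := by rw [hm]; exact Nat.le_ceil _
  have hn1 : s ^ 4 * L * l ^ 10 ≤ n := by rw [hn]; exact Nat.le_ceil _
  have one_le : ∀ i : ℕ, 1 ≤ s ^ 4 * L * l ^ i := fun i =>
    one_le_mul_of_one_le_of_one_le (one_le_mul_of_one_le_of_one_le hs4 hL1) (one_le_pow₀ hl1)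
  have hm2 : (m : ℝ) ≤ 2 * (s ^ 4 * L * l ^ 2) := by
    have := Nat.ceil_lt_add_one (zero_le_one.trans (one_le 2))
    rw [← hm] at this
    linarith [one_le 2]
  have hn2 : (n : ℝ) ≤ 2 * (s ^ 4 * L * l ^ 10) := by
    have := Nat.ceil_lt_add_one (zero_le_one.trans (one_le 10))
    rw [← hn] at this
    linarith [one_le 10]
  have hm0 : (1 : ℝ) ≤ m := (one_le 2).trans hm1
  have hn0 : (1 : ℝ) ≤ n := (one_le 10).trans hn1
  have hLL : ∀ i : ℕ, i ≤ 10 → 2 * (s ^ 4 * L * l ^ i) ≤ L ^ 2 := by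
    intro i hi
    calc 2 * (s ^ 4 * L * l ^ i) ≤ 2 * (l * L * l ^ 10) := by gcongr
      _ = (2 * l ^ 11) * L := by ring
      _ ≤ L * L := by gcongr
      _ = L ^ 2 := by ring
  have hmL : (m : ℝ) ≤ L ^ 2 := hm2.trans (hLL 2 (by norm_num))
  have hnL : (n : ℝ) ≤ L ^ 2 := hn2.trans (hLL 10 le_rfl)
  have hlogm : Real.log m ≤ 2 * l := by
    have := Real.log_le_log (by linarith) hmL
    rw [Real.log_pow, ← hlL] at this
    simpa using this
  have hlogn : Real.log n ≤ 2 * l := by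
    have := Real.log_le_log (by linarith) hnL
    rw [Real.log_pow, ← hlL] at this
    simpa using this
  have hJl : (J : ℝ) ≤ 4 * l := by
    have h1 : ((2 ^ Nat.log 2 m : ℕ) : ℝ) ≤ m :=
      Nat.cast_le.2 (Nat.pow_log_le_self 2 (by rintro rfl; norm_num at hm0))
    have h2 := Real.log_le_log (by positivity) h1
    push_cast at h2
    rw [Real.log_pow] at h2
    have h3 := Real.log_two_gt_d9
    have h4 : (Nat.log 2 m : ℝ) * (2 / 3) ≤ Nat.log 2 m * Real.log 2 := by gcongr; linarith
    rw [hJ]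
    push_cast
    linarith
  have hτ : 4 * Real.log (4 * n * m) + 1 ≤ 20 * l := by
    rw [Real.log_mul (by positivity) (by positivity), Real.log_mul (by positivity) (by positivity)]
    have := Real.log_le_sub_one_of_pos (show (0 : ℝ) < 4 by norm_num)
    linarith
  have hs3 : (1 / s) ^ 3 * s ^ 4 = s := by field_simp
  constructor
  · calc 10000 * J * L ≤ 10000 * (4 * l) * L := by gcongr
      _ = 1 * (40000 * l * L) := by ring
      _ ≤ s * (l * l * L) := by gcongr
      _ = (1 / s) ^ 3 * s ^ 4 * (l * l * L) := by rw [hs3]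
      _ = (1 / s) ^ 3 * (s ^ 4 * L * l ^ 2) := by ring
      _ ≤ _ := by gcongr
  · calc 4000 * m * (4 * Real.log (4 * n * m) + 1)
          ≤ 4000 * (2 * (s ^ 4 * L * l ^ 2)) * (20 * l) := by
          gcongr
          have := Real.log_nonneg (show (1 : ℝ) ≤ 4 * n * m by nlinarith)
          linarith
      _ = (4 * 40000 * s ^ 4) * (L * l ^ 3) := by ring
      _ ≤ (l * l * l) * (L * l ^ 3) := by gcongr; linarith
      _ = 1 * (L * l ^ 6) := by ring
      _ ≤ s * (L * l ^ 10) := by gcongr; norm_num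
      _ = (1 / s) ^ 3 * s ^ 4 * (L * l ^ 10) := by rw [hs3]
      _ = (1 / s) ^ 3 * (s ^ 4 * L * l ^ 10) := by ring
      _ ≤ _ := by gcongr

end Asymptotics

/-! ### Conclusion -/

theorem theorem2 (w : ℕ → ℝ) (hw : Tendsto w atTop atTop) :
    ∃ δ η : ℕ → ℝ, Tendsto δ atTop (𝓝 0) ∧ Tendsto η atTop (𝓝 0) ∧
      ∀ (G : Type u) [AddCommGroup G] [Fintype G] (N : ℕ), N = Fintype.card G →
        1 - η N ≤ (randomSubset G).real {A : Set G | ∀ X Y : Finset G,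
          w N * Real.log N * (Real.log (Real.log N)) ^ 2 ≤ (X.card : ℝ) →
          w N * Real.log N * (Real.log (Real.log N)) ^ 10 ≤ (Y.card : ℝ) →
          |edgeSum A X Y - 1 / 2 * (X.card : ℝ) * (Y.card : ℝ)|
            ≤ δ N * ((X.card : ℝ) * (Y.card : ℝ))} := by
  classical
  have hLt : Tendsto (fun N : ℕ => Real.log N) atTop atTop :=
    Real.tendsto_log_atTop.comp tendsto_natCast_atTop_atTop
  have hlt : Tendsto (fun N : ℕ => Real.log (Real.log N)) atTop atTop :=
    Real.tendsto_log_atTop.comp hLt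
  -- a slowly growing replacement for `w`, written as a fourth power
  set s : ℕ → ℝ := fun N => (min (w N) (Real.log (Real.log N))) ^ (1 / 4 : ℝ)
  have hmin : Tendsto (fun N : ℕ => min (w N) (Real.log (Real.log N))) atTop atTop :=
    tendsto_atTop.2 fun b => (((tendsto_atTop.1 hw) b).and ((tendsto_atTop.1 hlt) b)).mono
      fun N h => le_min h.1 h.2
  have hst : Tendsto s atTop atTop := (tendsto_rpow_atTop (by norm_num)).comp hmin
  set Large : ℕ → Prop := fun N => 40000 ≤ Real.log (Real.log N) ∧
    2 * Real.log (Real.log N) ^ 11 ≤ Real.log N ∧ 1 ≤ s N ∧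
    s N ^ 4 = min (w N) (Real.log (Real.log N))
  have hLarge : ∀ᶠ N in atTop, Large N := by
    have h11 : ∀ᶠ N : ℕ in atTop, 2 * Real.log (Real.log N) ^ 11 ≤ Real.log N := by
      have h := (Real.isLittleO_pow_log_id_atTop (n := 11)).bound (show (0 : ℝ) < 1 / 2 by norm_num)
      filter_upwards [hLt.eventually h, hLt.eventually_ge_atTop 0,
        hlt.eventually_ge_atTop 0] with N h1 h2 h3
      simp only [id, Real.norm_eq_abs] at h1
      rw [abs_of_nonneg h2, abs_of_nonneg (pow_nonneg h3 _)] at h1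
      linarith
    filter_upwards [hlt.eventually_ge_atTop 40000, h11, hst.eventually_ge_atTop 1,
      hmin.eventually_ge_atTop 0] with N h1 h2 h3 h4
    refine ⟨h1, h2, h3, ?_⟩
    simp only [s]
    rw [← Real.rpow_natCast, ← Real.rpow_mul h4]
    norm_num
  refine ⟨fun N => 1 / s N, fun N => if Large N then 4 / N else 1, ?_, ?_, ?_⟩
  · simp only [one_div]
    exact hst.inv_tendsto_atTop
  · refine (tendsto_const_div_atTop_nhds_zero_nat 4).congr' ?_
    filter_upwards [hLarge] with N hN
    rw [if_pos hN]
  · rintro G _ _ N rfl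
    by_cases hN : Large (Fintype.card G)
    swap
    · simp only [if_neg hN, sub_self]
      exact measureReal_nonneg
    simp only [if_pos hN]
    obtain ⟨h1, h2, h3, h4⟩ := hN
    set L := Real.log (Fintype.card G)
    set l := Real.log L
    set S := s (Fintype.card G)
    have hl0 : 0 ≤ l := by linarith
    have hL1 : 1 ≤ L := by
      have : 1 ≤ l ^ 11 := one_le_pow₀ (by linarith)
      linarith
    have hS : 0 < S := by linarith
    have hSw : S ^ 4 ≤ w (Fintype.card G) := h4.trans_le (min_le_left _ _)
    obtain ⟨c1, c2⟩ := size_conditions L l S rfl h1 h2 h3 (h4.trans_le (min_le_right _ _))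
      _ _ _ rfl rfl rfl
    have hbad := randomSubset_real_deviation_le (G := G) _ _ _ (1 / S) _ hL1 (by positivity)
      (by rw [div_le_one hS]; exact h3) (Nat.succ_pos _)
      (Nat.lt_pow_succ_log_self one_lt_two _) rfl c1 c2
    set Bad := {A : Set G | ∃ X Y : Finset G, ⌈S ^ 4 * L * l ^ 2⌉₊ ≤ X.card ∧
      ⌈S ^ 4 * L * l ^ 10⌉₊ ≤ Y.card ∧ 1 / S * (X.card * Y.card)
        < |edgeSum A X Y - 1 / 2 * (X.card : ℝ) * (Y.card : ℝ)|}
    set Good := {A : Set G | ∀ X Y : Finset G,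
      w (Fintype.card G) * L * l ^ 2 ≤ (X.card : ℝ) →
      w (Fintype.card G) * L * l ^ 10 ≤ (Y.card : ℝ) →
      |edgeSum A X Y - 1 / 2 * (X.card : ℝ) * (Y.card : ℝ)|
        ≤ 1 / S * ((X.card : ℝ) * (Y.card : ℝ))}
    have hcover : (Set.univ : Set (Set G)) ⊆ Good ∪ Bad := by
      intro A _
      by_contra hA
      rw [Set.mem_union, not_or] at hA
      refine hA.1 fun X Y hX hY => not_lt.1 fun hlt => hA.2 ⟨X, Y, ?_, ?_, hlt⟩
      · exact Nat.ceil_le.2 (le_trans (by gcongr) hX)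
      · exact Nat.ceil_le.2 (le_trans (by gcongr) hY)
    have h5 := (measureReal_mono hcover (measure_ne_top (randomSubset G) _)).trans
      (measureReal_union_le _ _)
    rw [probReal_univ] at h5
    linarith
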